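/- All topological groups are assumed Hausdorff (equivalently, Tychonoff). A topological space $X$ has an $\omega^\omega$-base if every point $x\in X$ has a neighbourhood base $\{U_\alpha[x]:\alpha\in\omega^\omega\}$ such that $U_\beta[x]\subseteq U_\alpha[x]$ whenever $\alpha\le\beta$ in $\omega^\omega$, where $\omega^\omega$ is the set of all functions $\omega\to\omega$ with the pointwise order. A subset $S$ of a topological group $G$ with identity $e$ is a suitable set for $G$ if $S$ is discrete in the subspace topology, $S\cup\{e\}$ is closed in $G$, and the subgroup generated by $S$ is dense in $G$. The group $G$ is precompact if for every neighbourhood $U$ of $e$ there is a finite set $F\subseteq G$ with $FU=G$. Theorem. Let $G$ be a separable (Hausdorff) topological group with an $\omega^\omega$-base. Then $G$ has a suitable set. Moreover, if $G$ is not precompact, then $G$ has a suitable set that is closed in $G$. -/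

import Mathlib

open scoped Pointwise Topology

/-- Every point has a neighbourhood base indexed by `ω^ω` (with the pointwise order)
that is decreasing in the index. -/
def HasOmegaOmegaBase (X : Type*) [TopologicalSpace X] : Prop :=
  ∀ x : X, ∃ U : (ℕ → ℕ) → Set X, (𝓝 x).HasAntitoneBasis U

/-- A suitable set of a topological group: a discrete subspace `S` such that `S ∪ {1}` is closed
and the subgroup generated by `S` is dense. -/
structure IsSuitableSet {G : Type*} [Group G] [TopologicalSpace G] (S : Set G) : Prop where
  isDiscrete : IsDiscrete S
  isClosed_union_one : IsClosed (S ∪ {1})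
  dense_closure : Dense (Subgroup.closure S : Set G)

/-- A topological group is precompact if for each neighbourhood `U` of the identity there is a
finite set `F` with `F U = G`. -/
def IsPrecompactGroup (G : Type*) [Group G] [TopologicalSpace G] : Prop :=
  ∀ U ∈ 𝓝 (1 : G), ∃ F : Set G, F.Finite ∧ F * U = Set.univ

/-! The proof splits on precompactness. If finitely many translates of some `U` never cover, choose
`x n` recursively so that both `x n` and `d n * x n`, with `d` a dense sequence, are `U`-separated;
together they form a closed discrete set whose group contains every `d n`. If `G` is precompact, a
diagonal argument shows that the countably many cylinder intersections capture the topology at `1`,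
so `G` is first countable there. Finite nets at shrinking scales then form a set converging to `1`
that generates a dense subgroup. -/

/-- A sequence can be chosen recursively so that all pairs of terms satisfy index-dependent
relations, if each finite initial segment can be extended. -/
theorem exists_seq_forall_lt {X : Type*} [Nonempty X] (r : ℕ → ℕ → X → X → Prop)
    (h : ∀ (n : ℕ) (f : ℕ → X), ∃ y, ∀ i < n, r i n (f i) y) :
    ∃ f : ℕ → X, ∀ i n, i < n → r i n (f i) (f n) := by
  classical
  choose g hg using h
  obtain ⟨x₀⟩ := ‹Nonempty X›
  let step : (n : ℕ) → ((m : ℕ) → m < n → X) → X := fun n ih =>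
    g n (fun i => if hi : i < n then ih i hi else x₀)
  let f : ℕ → X := Nat.lt_wfRel.wf.fix step
  have hf : ∀ n, f n = g n (fun i => if i < n then f i else x₀) := fun n => by
    have := Nat.lt_wfRel.wf.fix_eq step n
    simpa [step, f] using this
  refine ⟨f, fun i n hin => ?_⟩
  have := hg n (fun i => if i < n then f i else x₀) i hin
  rw [← hf n] at this
  simpa [hin] using this

section Group

variable {G : Type*} [Group G]

/-- The intersection of all members of a family indexed by `ω^ω` whose index extends a given
finite sequence. -/
def cylinderInter {X : Type*} (U : (ℕ → ℕ) → Set X) (s : Σ n : ℕ, Fin n → ℕ) : Set X :=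
  ⋂ β ∈ {β : ℕ → ℕ | ∀ i : Fin s.1, β i = s.2 i}, U β

theorem cylinderInter_subset {X : Type*} (U : (ℕ → ℕ) → Set X) (α : ℕ → ℕ) (n : ℕ) :
    cylinderInter U ⟨n, fun i => α i⟩ ⊆ U α :=
  Set.biInter_subset_of_mem (by simp)

/-- If no finite set of left translates of `A n` covers `G` for any `n`, there is a sequence
whose `n`-th term avoids the translates of `A n` by the previous terms. -/
theorem exists_seq_inv_mul_notMem (A : ℕ → Set G)
    (h : ∀ n, ∀ F : Set G, F.Finite → F * A n ≠ Set.univ) :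
    ∃ x : ℕ → G, ∀ i n, i < n → (x i)⁻¹ * x n ∉ A n := by
  refine exists_seq_forall_lt (fun _ n a b => a⁻¹ * b ∉ A n) fun n f => ?_
  obtain ⟨y, hy⟩ := (Set.ne_univ_iff_exists_notMem _).1
    (h n (f '' Set.Iio n) ((Set.finite_Iio n).image f))
  refine ⟨y, fun i hi hmem => hy ?_⟩
  exact ⟨f i, ⟨i, hi, rfl⟩, _, hmem, by simp⟩

variable [TopologicalSpace G]

/-- Pigeonhole: two terms lie in one translate `f * V`, and `V⁻¹ * V ⊆ U`. -/
theorem IsPrecompactGroup.exists_lt_inv_mul_mem [IsTopologicalGroup G]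
    (hp : IsPrecompactGroup G) {U : Set G} (hU : U ∈ 𝓝 (1 : G)) (x : ℕ → G) :
    ∃ i j, i < j ∧ (x i)⁻¹ * x j ∈ U := by
  obtain ⟨V, hV, -, hinv, hVU⟩ := exists_closed_nhds_one_inv_eq_mul_subset hU
  obtain ⟨F, hF, hFV⟩ := hp V hV
  have hc : ∀ n, ∃ f : F, ∃ v ∈ V, (f : G) * v = x n := fun n => by
    obtain ⟨f, hf, v, hv, h⟩ := (hFV ▸ Set.mem_univ (x n) : x n ∈ F * V)
    exact ⟨⟨f, hf⟩, v, hv, h⟩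
  choose c v hv hcv using hc
  have : Finite F := hF
  obtain ⟨i, j, hij, hcij⟩ := Finite.exists_ne_map_eq_of_infinite c
  have key : ∀ i j, c i = c j → (x i)⁻¹ * x j ∈ U := fun i j hcij => by
    refine hVU ⟨(v i)⁻¹, ?_, v j, hv j, ?_⟩
    · rw [← hinv]; exact Set.inv_mem_inv.2 (hv i)
    · simp [← hcv, hcij, mul_assoc]
  rcases lt_or_gt_of_ne hij with h | h
  · exact ⟨i, j, h, key i j hcij⟩
  · exact ⟨j, i, h, key j i hcij.symm⟩

/-- In a precompact group, every branch of an `ω^ω`-base contains a cylinder intersection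
finitely many translates of which cover the group. -/
theorem IsPrecompactGroup.exists_finite_mul_cylinderInter [IsTopologicalGroup G]
    (hp : IsPrecompactGroup G) {U : (ℕ → ℕ) → Set G} (hU : (𝓝 (1 : G)).HasAntitoneBasis U)
    (α : ℕ → ℕ) :
    ∃ n, ∃ F : Set G, F.Finite ∧ F * cylinderInter U ⟨n, fun i => α i⟩ = Set.univ := by
  by_contra! hcon
  obtain ⟨x, hx⟩ := exists_seq_inv_mul_notMem _ hcon
  have hβ : ∀ i n, ∃ β : ℕ → ℕ, (∀ m < n, β m = α m) ∧ (i < n → (x i)⁻¹ * x n ∉ U β) := by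
    intro i n
    by_cases hin : i < n
    · have := hx i n hin
      simp only [cylinderInter, Set.mem_iInter, not_forall, Set.mem_ofPred_eq] at this
      obtain ⟨β, hβ, h⟩ := this
      exact ⟨β, fun m hm => hβ ⟨m, hm⟩, fun _ => h⟩
    · exact ⟨α, fun _ _ => rfl, fun h => absurd h hin⟩
  choose β hβα hβx using hβ
  -- At coordinate `m` only the `β i n` with `n ≤ m` can differ from `α`, so a finite sum dominates
  -- all of them. Then `x` is `U γ`-separated, contradicting precompactness.
  let γ : ℕ → ℕ := fun m =>
    α m + ∑ n ∈ Finset.range (m + 1), ∑ i ∈ Finset.range n, β i n m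
  have hγ : ∀ i n, i < n → β i n ≤ γ := by
    intro i n hin m
    rcases lt_or_ge m n with hm | hm
    · rw [hβα i n m hm]; exact Nat.le_add_right _ _
    · calc β i n m ≤ ∑ i ∈ Finset.range n, β i n m :=
            Finset.single_le_sum (f := fun i => β i n m) (fun _ _ => Nat.zero_le _)
              (Finset.mem_range.2 hin)
        _ ≤ ∑ n ∈ Finset.range (m + 1), ∑ i ∈ Finset.range n, β i n m :=
            Finset.single_le_sum (f := fun n => ∑ i ∈ Finset.range n, β i n m)
              (fun _ _ => Nat.zero_le _) (Finset.mem_range.2 (by omega))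
        _ ≤ γ m := Nat.le_add_left _ _
  obtain ⟨i, j, hij, h⟩ := hp.exists_lt_inv_mul_mem (hU.1.mem_of_mem trivial : U γ ∈ _) x
  exact hβx i j hij (hU.2 (hγ i j hij) h)

/-- A finite union of closed sets with empty interior has empty interior, so `closure A` has an
interior point `x`, and `x⁻¹ * closure A` is already a neighbourhood of `1`. -/
theorem closure_inv_mul_closure_mem_nhds_one [IsTopologicalGroup G] {F A : Set G}
    (hF : F.Finite) (hFA : F * A = Set.univ) : (closure A)⁻¹ * closure A ∈ 𝓝 (1 : G) := by
  have hint : (interior (closure A)).Nonempty := by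
    by_contra hne
    rw [Set.not_nonempty_iff_eq_empty] at hne
    have huniv : (⋃ f ∈ F, f • closure A) = Set.univ := by
      refine Set.eq_univ_of_forall fun x => ?_
      obtain ⟨f, hf, a, ha, h⟩ := (hFA ▸ Set.mem_univ x : x ∈ F * A)
      exact Set.mem_biUnion hf ⟨a, subset_closure ha, h⟩
    have hempty : interior (⋃ f ∈ F, f • closure A) = ∅ := by
      clear huniv hFA
      induction F, hF using Set.Finite.induction_on with
      | empty => simp
      | @insert f F _ _ ih =>
        rw [Set.biUnion_insert, interior_union_isClosed_of_interior_empty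
          (isClosed_closure.smul f), interior_smul, hne, Set.smul_set_empty]
        exact ih
    rw [huniv, interior_univ] at hempty
    exact (Set.univ_nonempty (α := G)).ne_empty hempty
  obtain ⟨x, hx⟩ := hint
  have : (fun y => x * y) ⁻¹' closure A ∈ 𝓝 (1 : G) := by
    refine (continuous_const_mul x).continuousAt.preimage_mem_nhds ?_
    simpa using mem_interior_iff_mem_nhds.1 hx
  refine Filter.mem_of_superset this fun y hy => ?_
  exact ⟨x⁻¹, Set.inv_mem_inv.2 (interior_subset hx), x * y, hy, by simp⟩

/-- A precompact group with an `ω^ω`-base at the identity is first countable there. -/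
theorem IsPrecompactGroup.isCountablyGenerated_nhds_one [IsTopologicalGroup G]
    (hp : IsPrecompactGroup G) {U : (ℕ → ℕ) → Set G} (hU : (𝓝 (1 : G)).HasAntitoneBasis U) :
    (𝓝 (1 : G)).IsCountablyGenerated := by
  let N : (Σ n : ℕ, Fin n → ℕ) → Set G := fun s =>
    (closure (cylinderInter U s))⁻¹ * closure (cylinderInter U s)
  have hbasis : (𝓝 (1 : G)).HasBasis (fun s => N s ∈ 𝓝 (1 : G)) N := by
    refine ⟨fun t => ⟨fun ht => ?_, fun ⟨s, hs, hst⟩ => Filter.mem_of_superset hs hst⟩⟩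
    obtain ⟨V, hV, hVc, hinv, hVt⟩ := exists_closed_nhds_one_inv_eq_mul_subset ht
    obtain ⟨α, -, hα⟩ := hU.1.mem_iff.1 hV
    obtain ⟨n, F, hF, hFN⟩ := hp.exists_finite_mul_cylinderInter hU α
    have hcl : closure (cylinderInter U ⟨n, fun i => α i⟩) ⊆ V :=
      closure_minimal ((cylinderInter_subset U α n).trans hα) hVc
    refine ⟨_, closure_inv_mul_closure_mem_nhds_one hF hFN, ?_⟩
    refine (Set.mul_subset_mul (Set.inv_subset_inv.2 hcl) hcl).trans ?_
    rwa [hinv]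
  exact Filter.HasCountableBasis.isCountablyGenerated ⟨hbasis, Set.to_countable _⟩

/-- Every subset of a precompact group is covered by finitely many translates of a given
neighbourhood of the identity, with centres in the subset. -/
theorem IsPrecompactGroup.exists_finite_subset_mul [IsTopologicalGroup G]
    (hp : IsPrecompactGroup G) (A : Set G) {U : Set G} (hU : U ∈ 𝓝 (1 : G)) :
    ∃ F ⊆ A, F.Finite ∧ A ⊆ F * U := by
  by_contra! hcon
  obtain ⟨f, hf⟩ := exists_seq_of_forall_finset_exists (fun x => x ∈ A)
    (fun x y => x⁻¹ * y ∉ U) fun s hs => by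
      obtain ⟨y, hyA, hy⟩ := Set.not_subset.1 (hcon s hs s.finite_toSet)
      exact ⟨y, hyA, fun x hx hmem => hy ⟨x, hx, _, hmem, by simp⟩⟩
  obtain ⟨i, j, hij, h⟩ := hp.exists_lt_inv_mul_mem hU f
  exact hf.2 i j hij h

/-- If all but finitely many points of `S` lie in any given neighbourhood of the identity, then
`S \ {1}` is discrete and `S ∪ {1}` is closed. -/
theorem isDiscrete_and_isClosed_union_one [T2Space G] {S : Set G} (h1 : (1 : G) ∉ S)
    (hS : ∀ U ∈ 𝓝 (1 : G), (S \ U).Finite) : IsDiscrete S ∧ IsClosed (S ∪ {1}) := by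
  have hlocal : ∀ x : G, x ≠ 1 → ∃ V ∈ 𝓝 x, (V ∩ S).Finite := fun x hx => by
    obtain ⟨V, W, hV, hW, hxV, h1W, hd⟩ := t2_separation hx
    refine ⟨V, hV.mem_nhds hxV, (hS W (hW.mem_nhds h1W)).subset ?_⟩
    exact fun y hy => ⟨hy.2, Set.disjoint_left.1 hd hy.1⟩
  have hpunct : ∀ x : G, x ≠ 1 → ∃ V ∈ 𝓝 x, V ∩ S ⊆ {x} := fun x hx => by
    obtain ⟨V, hV, hfin⟩ := hlocal x hx
    have hfin' : ((V ∩ S) \ {x}).Finite := hfin.subset Set.sdiff_subset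
    refine ⟨V ∩ ((V ∩ S) \ {x})ᶜ, Filter.inter_mem hV
      (hfin'.isClosed.isOpen_compl.mem_nhds (by simp)), ?_⟩
    intro y hy
    by_contra hyx
    exact hy.1.2 ⟨⟨hy.1.1, hy.2⟩, hyx⟩
  constructor
  · refine .of_nhdsWithin fun x hx => ?_
    obtain ⟨V, hV, hVS⟩ := hpunct x (fun h => h1 (h ▸ hx))
    rw [Filter.le_pure_iff, mem_nhdsWithin_iff_exists_mem_nhds_inter]
    exact ⟨V, hV, hVS⟩
  · rw [← isOpen_compl_iff, isOpen_iff_mem_nhds]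
    intro x hx
    have hx1 : x ≠ 1 := fun h => hx (Or.inr h)
    obtain ⟨V, hV, hVS⟩ := hpunct x hx1
    filter_upwards [hV, isOpen_compl_singleton.mem_nhds hx1] with y hyV hy1 hy
    rcases hy with hy | hy
    · exact hx (Or.inl (hVS ⟨hyV, hy⟩ ▸ hy))
    · exact hy1 hy

/-- A first countable precompact Hausdorff group has a suitable set. -/
theorem IsPrecompactGroup.exists_isSuitableSet [IsTopologicalGroup G] [T2Space G]
    (hp : IsPrecompactGroup G) [(𝓝 (1 : G)).IsCountablyGenerated] :
    ∃ S : Set G, IsSuitableSet S := by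
  obtain ⟨V, hV⟩ := (𝓝 (1 : G)).exists_antitone_basis
  have hVmem : ∀ n, V n ∈ 𝓝 (1 : G) := fun n => hV.1.mem_of_mem trivial
  -- The shift by one matters: the error left by the nets up to stage `n` lies in `V n = A (n + 1)`,
  -- exactly the set that `F (n + 1)` approximates.
  let A : ℕ → Set G := fun n => n.casesOn Set.univ V
  choose F hFA hFfin hAF using fun n => hp.exists_finite_subset_mul (A n) (hVmem n)
  let S : Set G := (⋃ n, F n) \ {1}
  have hfin : ∀ U ∈ 𝓝 (1 : G), (S \ U).Finite := fun U hU => by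
    obtain ⟨n, -, hn⟩ := hV.1.mem_iff.1 hU
    refine ((Set.finite_Iic n).biUnion fun m _ => hFfin m).subset ?_
    rintro x ⟨⟨hx, -⟩, hxU⟩
    obtain ⟨m, hm⟩ := Set.mem_iUnion.1 hx
    refine Set.mem_biUnion (x := m) ?_ hm
    by_contra hmn
    obtain ⟨k, rfl⟩ : ∃ k, m = k + 1 := ⟨m - 1, by simp at hmn; omega⟩
    refine hxU (hn (hV.2 ?_ (hFA (k + 1) hm)))
    simp at hmn; omega
  have hFS : ∀ n, F n ⊆ Subgroup.closure S := fun n x hx => by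
    by_cases hx1 : x = 1
    · rw [hx1]; exact one_mem _
    · exact Subgroup.subset_closure ⟨Set.mem_iUnion.2 ⟨n, hx⟩, hx1⟩
  have happrox : ∀ n (x : G), ∃ g ∈ Subgroup.closure S, g⁻¹ * x ∈ V n := by
    intro n x
    induction n with
    | zero =>
      obtain ⟨f, hf, v, hv, rfl⟩ := hAF 0 (Set.mem_univ x)
      exact ⟨f, hFS 0 hf, by simpa using hv⟩
    | succ n ih =>
      obtain ⟨g, hg, hgx⟩ := ih
      obtain ⟨f, hf, v, hv, h⟩ := hAF (n + 1) hgx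
      refine ⟨g * f, mul_mem hg (hFS _ hf), ?_⟩
      have : (g * f)⁻¹ * x = v := by
        rw [mul_inv_rev, mul_assoc, ← h]; simp
      rwa [this]
  obtain ⟨hd, hc⟩ := isDiscrete_and_isClosed_union_one (S := S) (by simp [S]) hfin
  refine ⟨S, hd, hc, fun x => ?_⟩
  rw [mem_closure_iff_nhds]
  intro t ht
  have ht' : (fun y => x * y⁻¹) ⁻¹' t ∈ 𝓝 (1 : G) :=
    (by fun_prop : Continuous fun y : G => x * y⁻¹).continuousAt.preimage_mem_nhds (by simpa)
  obtain ⟨n, -, hn⟩ := hV.1.mem_iff.1 ht'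
  obtain ⟨g, hg, hgx⟩ := happrox n x
  exact ⟨g, by simpa using hn hgx, hg⟩

/-- The range of a left uniformly separated sequence is closed, and so are all its subsets. -/
theorem isClosed_of_subset_range_of_inv_mul_notMem [IsTopologicalGroup G] [T2Space G]
    {U : Set G} (hU : U ∈ 𝓝 (1 : G)) {x : ℕ → G} (hx : ∀ i j, i < j → (x i)⁻¹ * x j ∉ U)
    {T : Set G} (hT : T ⊆ Set.range x) : IsClosed T := by
  obtain ⟨V, hV, -, hinv, hVU⟩ := exists_closed_nhds_one_inv_eq_mul_subset hU
  have hsub : ∀ g : G, ((g • V) ∩ T).Subsingleton := by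
    have key : ∀ (g : G) i j, x i ∈ g • V → x j ∈ g • V → (x i)⁻¹ * x j ∈ U := by
      rintro g i j ⟨v, hv, hvi⟩ ⟨w, hw, hwj⟩
      refine hVU ⟨v⁻¹, ?_, w, hw, ?_⟩
      · rw [← hinv]; exact Set.inv_mem_inv.2 hv
      · simp [← hvi, ← hwj]
    rintro g a ⟨hag, haT⟩ b ⟨hbg, hbT⟩
    obtain ⟨i, rfl⟩ := hT haT
    obtain ⟨j, rfl⟩ := hT hbT
    rcases lt_trichotomy i j with h | rfl | h
    · exact absurd (key g i j hag hbg) (hx i j h)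
    · rfl
    · exact absurd (key g j i hbg hag) (hx j i h)
  rw [← isOpen_compl_iff, isOpen_iff_mem_nhds]
  intro g hg
  have hgV : g • V ∈ 𝓝 g := by simpa using smul_mem_nhds_smul (a := (1 : G)) g hV
  filter_upwards [hgV, ((hsub g).finite.isClosed.isOpen_compl.mem_nhds fun h => hg h.2)]
    with y hy hyT hy'
  exact hyT ⟨hy, hy'⟩

/-- A separable Hausdorff group that is not precompact has a closed suitable set. -/
theorem exists_isSuitableSet_isClosed_of_not_isPrecompactGroup [IsTopologicalGroup G] [T2Space G]
    [TopologicalSpace.SeparableSpace G] (hp : ¬ IsPrecompactGroup G) :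
    ∃ S : Set G, IsSuitableSet S ∧ IsClosed S := by
  simp only [IsPrecompactGroup, not_forall, not_exists, not_and] at hp
  obtain ⟨U, hU, hcov⟩ := hp
  let d : ℕ → G := TopologicalSpace.denseSeq G
  obtain ⟨x, hx⟩ := exists_seq_forall_lt
    (fun i n a b => a⁻¹ * b ∉ U ∧ (d i * a)⁻¹ * (d n * b) ∉ U) fun n (f : ℕ → G) => by
      obtain ⟨y, hy⟩ := (Set.ne_univ_iff_exists_notMem _).1
        -- Avoiding the second family of translates of `U` separates `d n * y` from each earlier `d
        -- i * f i`.
        (hcov (f '' Set.Iio n ∪ (fun i => (d n)⁻¹ * (d i * f i)) '' Set.Iio n)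
          (((Set.finite_Iio n).image _).union ((Set.finite_Iio n).image _)))
      refine ⟨y, fun i hi => ⟨fun h => hy ?_, fun h => hy ?_⟩⟩
      · exact ⟨f i, Or.inl ⟨i, hi, rfl⟩, _, h, by simp⟩
      · exact ⟨_, Or.inr ⟨i, hi, rfl⟩, _, h, by simp [mul_assoc]⟩
  let S : Set G := Set.range x ∪ Set.range fun n => d n * x n
  have hclosed : ∀ T ⊆ S, IsClosed T := fun T hT => by
    rw [← Set.inter_eq_left.2 hT, Set.inter_union_distrib_left]
    exact (isClosed_of_subset_range_of_inv_mul_notMem hU (fun i j h => (hx i j h).1)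
      Set.inter_subset_right).union
      (isClosed_of_subset_range_of_inv_mul_notMem hU (fun i j h => (hx i j h).2)
        Set.inter_subset_right)
  refine ⟨S, ⟨?_, (hclosed S subset_rfl).union isClosed_singleton, ?_⟩, hclosed S subset_rfl⟩
  · refine .of_nhdsWithin fun s hs => ?_
    rw [Filter.le_pure_iff, mem_nhdsWithin_iff_exists_mem_nhds_inter]
    refine ⟨(S \ {s})ᶜ, (hclosed _ Set.sdiff_subset).isOpen_compl.mem_nhds (by simp), ?_⟩
    intro y hy
    by_contra hys
    exact hy.1 ⟨hy.2, hys⟩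
  · refine (TopologicalSpace.denseRange_denseSeq G).mono ?_
    rintro _ ⟨n, rfl⟩
    have h1 : x n ∈ Subgroup.closure S := Subgroup.subset_closure (Or.inl ⟨n, rfl⟩)
    have h2 : d n * x n ∈ Subgroup.closure S := Subgroup.subset_closure (Or.inr ⟨n, rfl⟩)
    simpa using mul_mem h2 (inv_mem h1)

end Group

theorem mainTheorem11 (G : Type*) [Group G] [TopologicalSpace G] [IsTopologicalGroup G]
    [T2Space G] [TopologicalSpace.SeparableSpace G] (hG : HasOmegaOmegaBase G) :
    (∃ S : Set G, IsSuitableSet S) ∧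
      (¬ IsPrecompactGroup G → ∃ S : Set G, IsSuitableSet S ∧ IsClosed S) := by
  refine ⟨?_, exists_isSuitableSet_isClosed_of_not_isPrecompactGroup⟩
  by_cases hp : IsPrecompactGroup G
  · obtain ⟨U, hU⟩ := hG 1
    have := hp.isCountablyGenerated_nhds_one hU
    exact hp.exists_isSuitableSet
  · obtain ⟨S, hS, -⟩ := exists_isSuitableSet_isClosed_of_not_isPrecompactGroup hp
    exact ⟨S, hS⟩
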